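/- **Definitions.** Let $q$ be a prime power; all codes are linear over $\mathbb F_q$, and $[n,k,d]$ means length $n$, dimension $k$, minimum Hamming distance $d$. For a code $\mathcal C$ of length $n$ and $R\subseteq[n]$, $\mathcal C|_R$ is its restriction to the coordinates in $R$. Let $k_{\mathrm{opt}}^{(q)}(n,d)$ be the largest dimension of a linear code over $\mathbb F_q$ of length $n$ with minimum distance at least $d$ (the zero code is allowed, and a negative length counts as length $0$). Let $\mathcal G_q(k,d)=\sum_{i=0}^{k-1}\lceil d/q^i\rceil$; an $[n,k,d]$ code meets the Griesmer bound if $n=\mathcal G_q(k,d)$. *LRC.* $\mathcal C$ is an LRC with local parameters $[n',\kappa,\delta]$, where $\delta\ge2$, if every coordinate lies in a set $R$ such that $\mathcal C|_R$ is an $[n',\kappa,\delta]$ code; it then has locality $(r,\delta)$ with $r=n'-\delta+1$, i.e. every coordinate lies in a set $R$ with $|R|\le r+\delta-1$ for which $\mathcal C|_R$ has minimum distance at least $\delta$. It is an *optimal* LRC for this locality if its length $n$, dimension $k$ and minimum distance $d$ satisfy $$k=\min_{\lambda\in\mathbb Z_{\ge0}}\bigl\{\lambda+k_{\mathrm{opt}}^{(q)}(n-\mu(\lambda),d)\bigr\},\qquad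 \mu(\lambda)=(a+1)\mathcal G_q(\kappa,\delta)-\mathcal G_q(\kappa-b,\delta),$$ where $\lambda=a\kappa+b$ with $0\le b<\kappa$. *H-LRC.* $\mathcal C$ has $h$-level hierarchical locality with parameters $[(r_1,\delta_1),\dots,(r_h,\delta_h)]$, where $r_1\ge\dots\ge r_h$ and $\delta_1>\dots>\delta_h\ge2$, if for every coordinate $i$ there are sets $L_1,\dots,L_h\ni i$ such that, for each $j$, $\dim\mathcal C|_{L_j}\le r_j$, the minimum distance of $\mathcal C|_{L_j}$ is at least $\delta_j$, and $\mathcal C|_{L_j}$ has $(h-j)$-level hierarchical locality with parameters $[(r_{j+1},\delta_{j+1}),\dots,(r_h,\delta_h)]$ ($0$-level hierarchical locality is no condition). It is an *optimal* H-LRC for these parameters if $$k=\min_{\lambda\in\mathbb Z_{\ge0}}\bigl\{\lambda+k_{\mathrm{opt}}^{(q)}(n-\nu(\lambda),d)\bigr\},\qquad \nu(\lambda)=\lambda+\Bigl\lfloor\frac{\lambda}{r_h}\Bigr\rfloor(\delta_h-1)+\sum_{l=1}^{h-1}\Bigl\lfloor\frac{\lambda}{r_l}\Bigr\rfloor(\delta_l-\delta_{l+1}),$$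 with $\nu(\lambda)=\lambda$ when $h=0$. *The code.* A generator matrix $G_m$ of the simplex code $\mathcal S(m)$ has as columns exactly one representative of each one-dimensional subspace of $\mathbb F_q^m$. The code $\mathcal S(m)-\mathcal S(s)$ is generated by the matrix obtained from $G_m$ by deleting the columns that are, up to a nonzero scalar, the columns of $G_s$ with $m-s$ zeros prepended. For $\kappa\ge1$ and $0\le i\le\kappa-1$ put $$d(\kappa,i)=\begin{cases}q^{\kappa-1}-q^{i-1}&\text{if } i>0,\\ q^{\kappa-1}&\text{if } i=0.\end{cases}$$ **Theorem.** Let $m\ge3$, $0\le s\le m-1$ and $\mathcal C=\mathcal S(m)-\mathcal S(s)$. Then $\mathcal C$ is a $\bigl[\frac{q^m-q^s}{q-1},\,m,\,d(m,s)\bigr]$ code that meets the Griesmer bound. Moreover: 1. $\mathcal C$ is an optimal LRC for each of the following local parameters: - $\bigl[\frac{q^\kappa-q^i}{q-1},\,\kappa,\,d(\kappa,i)\bigr]$ for all integers $3\le\kappa\le m-1$ and $\max\{0,s-m+\kappa\}\le i\le\min\{s,\kappa-1\}$; - $[q+1,2,q]$ if $s\le m-2$; - $[q,2,q-1]$ if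 $q>2$ and $s\ge1$. 2. Put $\delta_\kappa=d(\kappa,\max\{0,s-m+\kappa\})$. - If $q>2$, or $q=2$ and $s<m-1$, then $\mathcal C$ is an optimal H-LRC with $(m-2)$-level hierarchical locality with parameters $[(m-1,\delta_{m-1}),(m-2,\delta_{m-2}),\dots,(2,\delta_2)]$. - If $q=2$ and $s=m-1$, then $\mathcal C$ is an optimal H-LRC with $(m-3)$-level hierarchical locality with parameters $[(m-1,\delta_{m-1}),\dots,(3,\delta_3)]$. -/

import Mathlib

section LinearCodes

universe u v

variable {F : Type v} [Field F]

/-- Restriction of a linear code (with coordinate set `ι`) to the coordinates in `S`. -/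
def codeRestrict {ι : Type u} (C : Submodule F (ι → F)) (S : Finset ι) :
    Submodule F (S → F) :=
  C.map (LinearMap.funLeft F F (Subtype.val : S → ι))

/-- Minimum Hamming distance between distinct codewords (`⊤` for the zero code). -/
noncomputable def minDist [DecidableEq F] {ι : Type u} [Fintype ι]
    (C : Submodule F (ι → F)) : ℕ∞ :=
  ⨅ (x ∈ C) (y ∈ C) (_ : x ≠ y), (hammingDist x y : ℕ∞)

/-- `C` is an `[n, k, d]` code. -/
def HasParams [DecidableEq F] {ι : Type u} [Fintype ι]
    (C : Submodule F (ι → F)) (n k d : ℕ) : Prop :=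
  Fintype.card ι = n ∧ Module.finrank F C = k ∧ minDist C = (d : ℕ∞)

/-- The largest dimension of a linear code of length `n` over `F` with minimum distance at
least `d`. The zero code is allowed, so that the value is `0` if there is no other code. -/
noncomputable def kOpt (F : Type v) [Field F] [DecidableEq F] (n : ℕ) (d : ℕ∞) : ℕ :=
  sSup {k | ∃ C : Submodule F (Fin n → F), Module.finrank F C = k ∧ d ≤ minDist C}

/-- The Griesmer sum `∑_{i < k} ⌈d / q ^ i⌉`. -/
def griesmer (q k d : ℕ) : ℕ :=
  ∑ i ∈ Finset.range k, ⌈(d : ℚ) / (q : ℚ) ^ i⌉₊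

/-- `C` attains the Griesmer bound `n ≥ ∑_{i < k} ⌈d / q ^ i⌉`. -/
def MeetsGriesmer [Fintype F] [DecidableEq F] {ι : Type u} [Fintype ι]
    (C : Submodule F (ι → F)) : Prop :=
  ∃ d : ℕ, minDist C = (d : ℕ∞) ∧
    Fintype.card ι = griesmer (Fintype.card F) (Module.finrank F C) d

/-! ### Locally repairable codes -/

/-- All-symbol locality `(r, δ)`. -/
def HasLocality [DecidableEq F] {ι : Type u} [Fintype ι]
    (C : Submodule F (ι → F)) (r δ : ℕ) : Prop :=
  ∀ i : ι, ∃ R : Finset ι, i ∈ R ∧ R.card ≤ r + δ - 1 ∧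
    (δ : ℕ∞) ≤ minDist (codeRestrict C R)

/-- Every code symbol lies in a set `R` such that the restriction to `R` is an `[n, κ, δ]` code,
where `δ ≥ 2`. -/
def HasLocalParams [DecidableEq F] {ι : Type u} [Fintype ι]
    (C : Submodule F (ι → F)) (n κ δ : ℕ) : Prop :=
  2 ≤ δ ∧ ∀ i : ι, ∃ R : Finset ι, i ∈ R ∧ HasParams (codeRestrict C R) n κ δ

/-- The number `μ = (a + 1) G_q(κ, δ) - G_q(κ - b, δ)`, where `l = a κ + b`, `0 ≤ b < κ`. -/
def lrcMu (q κ δ l : ℕ) : ℕ :=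
  (l / κ + 1) * griesmer q κ δ - griesmer q (κ - l % κ) δ

/-- `C` is an LRC with local code parameters `[n, κ, δ]` (hence with locality
`(n - δ + 1, δ)`) and attains the bound `k ≤ min_l (l + k_opt (length - μ(l), d))`. -/
def IsOptimalLRC [Fintype F] [DecidableEq F] {ι : Type u} [Fintype ι]
    (C : Submodule F (ι → F)) (n κ δ : ℕ) : Prop :=
  HasLocalParams C n κ δ ∧ HasLocality C (n - δ + 1) δ ∧
    IsLeast
      (Set.range fun l : ℕ =>
        l + kOpt F (Fintype.card ι - lrcMu (Fintype.card F) κ δ l) (minDist C))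
      (Module.finrank F C)

/-! ### Codes with hierarchical locality -/

/-- Hierarchical locality with parameters `[(r_1, δ_1), …, (r_h, δ_h)]`, where `h` is the length
of the list: for every symbol `i` there are sets `L_1, …, L_h` containing `i` such that, for each
`j`, the restriction to `L_j` has dimension at most `r_j`, minimum distance at least `δ_j` and
`(h - j)`-level hierarchical locality with parameters `[(r_{j+1}, δ_{j+1}), …, (r_h, δ_h)]`. -/
def HasHierLocality [DecidableEq F] (ps : List (ℕ × ℕ)) {ι : Type u} [Fintype ι]
    (C : Submodule F (ι → F)) : Prop :=
  ∀ i : ι, ∃ L : Fin ps.length → Finset ι, ∀ j : Fin ps.length,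
    i ∈ L j ∧
    Module.finrank F (codeRestrict C (L j)) ≤ (ps.get j).1 ∧
    ((ps.get j).2 : ℕ∞) ≤ minDist (codeRestrict C (L j)) ∧
    HasHierLocality (ps.drop (j + 1)) (codeRestrict C (L j))
termination_by ps.length
decreasing_by
  have := j.isLt
  simp only [List.length_drop]
  omega

/-- An H-LRC: hierarchical locality where `r_1 ≥ … ≥ r_h` and `δ_1 > … > δ_h ≥ 2`. -/
def IsHLRC [DecidableEq F] (ps : List (ℕ × ℕ)) {ι : Type u} [Fintype ι]
    (C : Submodule F (ι → F)) : Prop :=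
  ps.Pairwise (fun p p' => p'.1 ≤ p.1 ∧ p'.2 < p.2) ∧ (∀ p ∈ ps, 2 ≤ p.2) ∧
    HasHierLocality ps C

/-- The number
`ν = l + ⌊l / r_h⌋ (δ_h - 1) + ∑_{t < h} ⌊l / r_t⌋ (δ_t - δ_{t+1})` (just `l` if `h = 0`). -/
def hlrcNu : List (ℕ × ℕ) → ℕ → ℕ
  | [], l => l
  | [(r, δ)], l => l + l / r * (δ - 1)
  | (r, δ) :: (r', δ') :: ps, l => l / r * (δ - δ') + hlrcNu ((r', δ') :: ps) l

/-- `C` is an H-LRC with the given parameters and attains the bound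
`k ≤ min_l (l + k_opt (length - ν(l), d))`. -/
def IsOptimalHLRC [DecidableEq F] (ps : List (ℕ × ℕ)) {ι : Type u} [Fintype ι]
    (C : Submodule F (ι → F)) : Prop :=
  IsHLRC ps C ∧
    IsLeast
      (Set.range fun l : ℕ => l + kOpt F (Fintype.card ι - hlrcNu ps l) (minDist C))
      (Module.finrank F C)

/-! ### Simplex codes and the code `S(m) - S(s)` -/

/-- `G` is a generator matrix of the simplex code `S(m)`: its columns are pairwise linearly
independent (in particular nonzero) and every vector of `F ^ m` is a multiple of a column if it
is not zero. -/
def IsSimplexMatrix {m : ℕ} {ι : Type u} (G : Matrix (Fin m) ι F) : Prop :=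
  (∀ j, G.col j ≠ 0) ∧
  (∀ j j', j ≠ j' → LinearIndependent F ![G.col j, G.col j']) ∧
  ∀ w : Fin m → F, w ≠ 0 → ∃ (j : ι) (a : F), w = a • G.col j

/-- Prepend zeros to a vector of length `s` to obtain a vector of length `m`. -/
def prependZeros {s : ℕ} (m : ℕ) (w : Fin s → F) (i : Fin m) : F :=
  if h : m - s ≤ i.val then w ⟨i.val - (m - s), by have := i.isLt; omega⟩ else 0

open Classical in
/-- The columns of `G` that remain after the columns of `G'`, extended by zeros, have been
deleted (columns are identified if they are proportional). -/
noncomputable def remainingColumns {m s : ℕ} {ι : Type u} [Fintype ι] {ι' : Type*}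
    (G : Matrix (Fin m) ι F) (G' : Matrix (Fin s) ι' F) : Finset ι :=
  Finset.univ.filter fun j =>
    ¬ ∃ (t : ι') (a : F), a ≠ 0 ∧ G.col j = a • prependZeros m (G'.col t)

/-- The code `S(m) - S(s)` generated by the remaining columns. -/
noncomputable def simplexDiff {m s : ℕ} {ι : Type u} [Fintype ι] {ι' : Type*}
    (G : Matrix (Fin m) ι F) (G' : Matrix (Fin s) ι' F) :
    Submodule F (remainingColumns G G' → F) :=
  Submodule.span F
    (Set.range (G.submatrix id (Subtype.val : remainingColumns G G' → ι)).row)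

/-- The length `(q ^ κ - q ^ i) / (q - 1)` of `S(κ) - S(i)`. -/
def diffLength (q κ i : ℕ) : ℕ := (q ^ κ - q ^ i) / (q - 1)

/-- The minimum distance of `S(κ) - S(i)`. -/
def diffDist (q κ i : ℕ) : ℕ :=
  if i = 0 then q ^ (κ - 1) else q ^ (κ - 1) - q ^ (i - 1)

/-- The parameters `[(m - 1, δ_{m-1}), (m - 2, δ_{m-2}), …, (m - h, δ_{m-h})]`, where `δ_κ` is the
minimum distance of `S(κ) - S(max {0, s - m + κ})`. -/
def diffHierParams (q m s h : ℕ) : List (ℕ × ℕ) :=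
  (List.range h).map fun t => (m - 1 - t, diffDist q (m - 1 - t) (s + (m - 1 - t) - m))

end LinearCodes

/-! ### Codeword weights, the Griesmer bound, and shortening -/

section GriesmerBound

universe u v

variable {F : Type v} [Field F] [DecidableEq F]

/-! The code is read geometrically. Its words are the value tables of linear functionals on `V = F ^
m` at the projective points outside an `s`-dimensional subspace `S` (`IsPointDiff`, `evCode`). A
nonzero functional has weight `q ^ (m - 1)` if it vanishes on `S` and `q ^ (m - 1) - q ^ (s - 1)`
otherwise, which gives all parameters. Restricting to the points in a subspace `W` gives a code of
the same kind, for the pair `W`, `W ⊓ S` (`hasParams_codeRestrict`). Hence all the local codes and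
all the hierarchical levels come from choosing subspaces through a given point with prescribed
dimension and prescribed intersection with `S`.

Both optimality claims follow from one lemma, `isLeast_finrank`. At `l = 0` the value is `m`: since
the code meets the Griesmer bound, no code of the same length and distance has larger dimension. For
the other `l`, shorten at the points of an `l`-dimensional `W` that meets `S` as little as possible.
This costs at most `l` dimensions and removes all points of `W`, of which there are `(q ^ l - q ^ (l
- c)) / (q - 1)` with `c = m - s` and truncated `l - c`. So it suffices that `μ(l)` and `ν(l)` do
not exceed this number. The general LRC and H-LRC bounds are never needed.

The point count is a sum over `t < l` of the distances `e t = diffDist q (t + 1) (t + 1 - c)`, which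
are nondecreasing in `t`. For `μ`, cut this sum into blocks of length `κ` (`lrcMu_mul_add_le`). For
`ν`, truncate the summands at the top level and add the levels one at a time (`hlrcNu_le_sum_min`).
-/

theorem le_minDist_iff {ι : Type u} [Fintype ι] (C : Submodule F (ι → F)) (d : ℕ∞) :
    d ≤ minDist C ↔ ∀ x ∈ C, x ≠ 0 → d ≤ (hammingNorm x : ℕ∞) := by
  unfold minDist
  simp only [le_iInf_iff]
  constructor
  · intro h x hx hx0
    simpa [hammingDist_zero_right] using h x hx 0 C.zero_mem hx0
  · intro h x hx y hy hxy
    rw [hammingDist_eq_hammingNorm]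
    rw [neg_add_eq_sub]
    exact h _ (C.sub_mem hy hx) (sub_ne_zero.2 hxy.symm)

theorem minDist_le_hammingNorm {ι : Type u} [Fintype ι] {C : Submodule F (ι → F)} {x : ι → F}
    (hx : x ∈ C) (hx0 : x ≠ 0) : minDist C ≤ (hammingNorm x : ℕ∞) :=
  (le_minDist_iff C _).1 le_rfl x hx hx0

theorem griesmer_mono (q k : ℕ) {d e : ℕ} (h : d ≤ e) : griesmer q k d ≤ griesmer q k e := by
  unfold griesmer
  gcongr

/-- Nested ceilings collapse: rounding up `d / q` before dividing by `q ^ i` and rounding up again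
changes nothing. This is the recursion that passing to a residual code follows. -/
theorem griesmer_succ (q k d : ℕ) :
    griesmer q (k + 1) d = d + griesmer q k ⌈(d : ℚ) / q⌉₊ := by
  unfold griesmer
  rw [Finset.sum_range_succ', add_comm]
  congr 1
  · simp
  · refine Finset.sum_congr rfl fun i _ => ?_
    rw [pow_succ', ← div_div]
    refine eq_of_forall_ge_iff fun n => ?_
    rcases Nat.eq_zero_or_pos q with rfl | hq
    · simp
    have hq' : (0 : ℚ) < (q : ℚ) ^ i := by positivity
    rw [Nat.ceil_le, Nat.ceil_le, div_le_iff₀ hq', div_le_iff₀ hq']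
    have : (n : ℚ) * (q : ℚ) ^ i = ((n * q ^ i : ℕ) : ℚ) := by push_cast; rfl
    rw [this, ← Nat.ceil_le, Nat.cast_le]

theorem griesmer_mono_left (q d : ℕ) {k l : ℕ} (h : k ≤ l) : griesmer q k d ≤ griesmer q l d :=
  Finset.sum_le_sum_of_subset (Finset.range_mono h)

/-- Summing the weights of the words `x - a c` over all scalars `a`. -/
theorem sum_hammingNorm_sub_smul [Fintype F] {ι : Type u} [Fintype ι] (c x : ι → F) :
    ∑ a : F, hammingNorm (x - a • c) =
      (Fintype.card F - 1) * hammingNorm c +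
        Fintype.card F * (Finset.univ.filter fun j => c j = 0 ∧ x j ≠ 0).card := by
  classical
  have h1 : ∀ a : F, hammingNorm (x - a • c) = ∑ j, if x j - a * c j ≠ 0 then 1 else 0 := by
    intro a
    rw [hammingNorm, Finset.card_filter]
    simp
  have h2 : ∀ j, (∑ a : F, if x j - a * c j ≠ 0 then 1 else 0) =
      (Fintype.card F - 1) * (if c j ≠ 0 then 1 else 0) +
        Fintype.card F * (if c j = 0 ∧ x j ≠ 0 then 1 else 0) := by
    intro j
    by_cases hc : c j = 0
    · by_cases hx : x j = 0 <;> simp [hc, hx]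
    · have : (Finset.univ.filter fun a : F => x j - a * c j ≠ 0) =
          Finset.univ.erase (x j / c j) := by
        ext a
        simp only [Finset.mem_filter, Finset.mem_univ, true_and, Finset.mem_erase, and_true,
          ne_eq, sub_eq_zero]
        rw [not_iff_not, eq_div_iff hc, eq_comm]
      rw [← Finset.card_filter, this, Finset.card_erase_of_mem (Finset.mem_univ _)]
      simp [hc]
  simp only [h1]
  rw [Finset.sum_comm, Finset.sum_congr rfl fun j _ => h2 j, Finset.sum_add_distrib,
    ← Finset.mul_sum, ← Finset.mul_sum, ← Finset.card_filter, ← Finset.card_filter]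
  rfl

/-- The Griesmer bound. -/
theorem griesmer_le_card [Fintype F] (k : ℕ) : ∀ {ι : Type u} [Fintype ι]
    (C : Submodule F (ι → F)) (d : ℕ), k ≤ Module.finrank F C →
    (∀ x ∈ C, x ≠ 0 → d ≤ hammingNorm x) → griesmer (Fintype.card F) k d ≤ Fintype.card ι := by
  classical
  induction k with
  | zero => intro ι _ C d _ _; simp [griesmer]
  | succ k ih =>
    intro ι _ C d hk hd
    have hq : 0 < Fintype.card F := Fintype.card_pos
    -- The residual argument needs the true minimum weight `w`, attained by `c`, rather than the
    -- lower bound `d`; `griesmer_mono` returns to `d` at the end.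
    have hex : ∃ w, ∃ c ∈ C, c ≠ 0 ∧ hammingNorm c = w := by
      have : C ≠ ⊥ := by
        rintro rfl
        simp at hk
      obtain ⟨c, hc, hc0⟩ := C.ne_bot_iff.1 this
      exact ⟨_, c, hc, hc0, rfl⟩
    obtain ⟨c, hc, hc0, hcw⟩ := Nat.find_spec hex
    have hmin : ∀ x ∈ C, x ≠ 0 → hammingNorm c ≤ hammingNorm x := fun x hx hx0 =>
      hcw ▸ Nat.find_min' hex ⟨x, hx, hx0, rfl⟩
    set w := hammingNorm c with hw
    let J : Type u := {j : ι // c j = 0}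
    let π : (ι → F) →ₗ[F] (J → F) := LinearMap.funLeft F F (Subtype.val : J → ι)
    have hwt : ∀ x : ι → F, hammingNorm (π x) =
        (Finset.univ.filter fun j => c j = 0 ∧ x j ≠ 0).card := by
      intro x
      rw [hammingNorm, ← Finset.card_map (Function.Embedding.subtype fun j => c j = 0)]
      congr 1
      ext j
      simp only [Finset.mem_map, Finset.mem_filter, Finset.mem_univ, true_and]
      constructor
      · rintro ⟨i, hi, rfl⟩
        exact ⟨i.2, hi⟩
      · rintro ⟨h, hj⟩
        exact ⟨⟨j, h⟩, hj, rfl⟩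
    -- All `q` words `x - a • c` are nonzero, so their weights add up to at least `q * w`. The
    -- nonzero positions of `c` account for exactly `(q - 1) * w` of the total, and the zeros of `c`
    -- must supply the rest.
    have key : ∀ x ∈ C, x ∉ Submodule.span F {c} → w ≤ Fintype.card F * hammingNorm (π x) := by
      intro x hx hxc
      have h := sum_hammingNorm_sub_smul c x
      have hge : Fintype.card F * w ≤ ∑ a : F, hammingNorm (x - a • c) := by
        have := Finset.card_nsmul_le_sum Finset.univ (fun a : F => hammingNorm (x - a • c)) w
          fun a _ => hmin _ (C.sub_mem hx (C.smul_mem a hc)) fun h0 => hxc <|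
            Submodule.mem_span_singleton.2 ⟨a, (sub_eq_zero.1 h0).symm⟩
        simpa using this
      rw [h, ← hwt] at hge
      obtain ⟨r, hr⟩ : ∃ r, Fintype.card F = r + 1 := ⟨_, (Nat.succ_pred_eq_of_pos hq).symm⟩
      rw [hr] at hge ⊢
      simp only [Nat.add_sub_cancel] at hge
      linarith
    have hwpos : 0 < w := hammingNorm_pos_iff.2 hc0
    have hker : ∀ x ∈ C, π x = 0 → x ∈ Submodule.span F {c} := by
      intro x hx hx0
      by_contra hxc
      have := key x hx hxc
      rw [hx0, hammingNorm_zero] at this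
      omega
    let f : C →ₗ[F] (J → F) := π.comp C.subtype
    have hrank : k ≤ Module.finrank F (LinearMap.range f) := by
      have h1 := f.finrank_range_add_finrank_ker
      have h2 : Module.finrank F (LinearMap.ker f) ≤ 1 := by
        have : (LinearMap.ker f).map C.subtype ≤ Submodule.span F {c} := by
          rintro _ ⟨x, hx, rfl⟩
          exact hker x x.2 hx
        have h3 := Submodule.finrank_mono this
        rw [LinearEquiv.finrank_eq ((Submodule.equivMapOfInjective C.subtype
          C.injective_subtype (LinearMap.ker f)).symm), finrank_span_singleton hc0] at h3
        exact h3
      omega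
    -- The residual code, on the zeros of `c`, loses at most one dimension and has nonzero weights
    -- at least `⌈w / q⌉`.
    have hres := ih (LinearMap.range f) ⌈(w : ℚ) / Fintype.card F⌉₊ hrank (by
      rintro _ ⟨x, rfl⟩ hx0
      have hxc : (x : ι → F) ∉ Submodule.span F {c} := by
        intro h
        obtain ⟨a, ha⟩ := Submodule.mem_span_singleton.1 h
        apply hx0
        funext j
        simp [f, π, LinearMap.funLeft_apply, ← ha, j.2]
      rw [Nat.ceil_le, div_le_iff₀ (by exact_mod_cast hq), mul_comm]
      exact_mod_cast key x x.2 hxc)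
    have hcard : w + Fintype.card J = Fintype.card ι := by
      have := Fintype.card_subtype_compl (fun j => c j = 0)
      have h2 := Fintype.card_subtype_le (fun j => c j = 0)
      have h3 : w = Fintype.card {j // ¬ c j = 0} := by
        rw [hw, hammingNorm, Fintype.card_subtype]
      simp only [J]
      omega
    calc griesmer (Fintype.card F) (k + 1) d ≤ griesmer (Fintype.card F) (k + 1) w :=
          griesmer_mono _ _ (hd c hc hc0)
      _ ≤ Fintype.card ι := by
          rw [griesmer_succ, ← hcard]
          exact Nat.add_le_add_left hres _

theorem kOpt_bddAbove (n : ℕ) (d : ℕ∞) :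
    BddAbove {k | ∃ C : Submodule F (Fin n → F), Module.finrank F C = k ∧ d ≤ minDist C} := by
  refine ⟨n, ?_⟩
  rintro _ ⟨C, rfl, _⟩
  simpa using C.finrank_le

/-- A length that attains the Griesmer bound determines the optimal dimension. -/
theorem kOpt_le_of_griesmer [Fintype F] {n k d : ℕ}
    (hn : n < griesmer (Fintype.card F) (k + 1) d) : kOpt F n d ≤ k := by
  apply csSup_le'
  rintro _ ⟨C, rfl, hC⟩
  by_contra! hlt
  have := griesmer_le_card (k + 1) C d hlt fun x hx hx0 => by
    exact_mod_cast (le_minDist_iff C d).1 hC x hx hx0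
  rw [Fintype.card_fin] at this
  omega

/-- Shortening a code in a set of coordinates of small rank. -/
theorem finrank_le_add_kOpt {ι : Type u} [Fintype ι] (C : Submodule F (ι → F)) (I : Finset ι)
    {l μ : ℕ} (hl : Module.finrank F (codeRestrict C I) ≤ l) (hμ : μ ≤ I.card) :
    Module.finrank F C ≤ l + kOpt F (Fintype.card ι - μ) (minDist C) := by
  classical
  set N := Fintype.card ι - μ
  have hcard : Fintype.card {j // j ∉ I} ≤ Fintype.card (Fin N) := by
    rw [Fintype.card_subtype_compl, Fintype.card_fin, Fintype.card_coe]
    omega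
  obtain ⟨e⟩ := Function.Embedding.nonempty_of_card_le hcard
  -- Only `μ ≤ I.card` is known, so `N` may exceed the number of coordinates outside `I`; the
  -- shortened words are padded with zeros.
  let T : (ι → F) →ₗ[F] (Fin N → F) :=
    (Function.ExtendByZero.linearMap F e).comp
      (LinearMap.funLeft F F (Subtype.val : {j // j ∉ I} → ι))
  have hT : ∀ (x : ι → F) (j : {j // j ∉ I}), T x (e j) = x j := by
    intro x j
    exact e.injective.extend_apply _ _ j
  let f : C →ₗ[F] (I → F) := (LinearMap.funLeft F F (Subtype.val : I → ι)).comp C.subtype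
  have hf : LinearMap.range f = codeRestrict C I := by
    rw [LinearMap.range_comp, Submodule.range_subtype]
    rfl
  -- The words of `C` that vanish on `I`: deleting `I` costs them no weight, and by rank-nullity
  -- their dimension is at least `finrank F C - l`.
  let D : Submodule F (ι → F) := (LinearMap.ker f).map C.subtype
  have hDrank : Module.finrank F D = Module.finrank F (LinearMap.ker f) :=
    (LinearEquiv.finrank_eq (Submodule.equivMapOfInjective C.subtype
          C.injective_subtype (LinearMap.ker f))).symm
  have hDC : ∀ x ∈ D, x ∈ C ∧ ∀ j ∈ I, x j = 0 := by
    rintro _ ⟨x, hx, rfl⟩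
    exact ⟨x.2, fun j hj => congrFun (LinearMap.mem_ker.1 hx) ⟨j, hj⟩⟩
  have hwt : ∀ x ∈ D, hammingNorm x ≤ hammingNorm (T x) := by
    intro x hx
    have hxI : ∀ j, x j ≠ 0 → j ∉ I := fun j hj hjI => hj ((hDC x hx).2 j hjI)
    have h1 : hammingNorm x = (Finset.univ.filter fun j : {j // j ∉ I} => x j ≠ 0).card := by
      rw [hammingNorm, ← Finset.card_map (Function.Embedding.subtype fun j => j ∉ I)]
      congr 1
      ext j
      simp only [Finset.mem_map, Finset.mem_filter, Finset.mem_univ, true_and]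
      constructor
      · intro h
        exact ⟨⟨j, hxI j h⟩, h, rfl⟩
      · rintro ⟨i, hi, rfl⟩
        exact hi
    rw [h1, ← Finset.card_map e]
    refine Finset.card_le_card fun k hk => ?_
    obtain ⟨j, hj, rfl⟩ := Finset.mem_map.1 hk
    rw [Finset.mem_filter] at hj ⊢
    exact ⟨Finset.mem_univ _, by rw [hT]; exact hj.2⟩
  have hinj : ∀ x ∈ D, x ≠ 0 → T x ≠ 0 := fun x hx hx0 =>
    hammingNorm_pos_iff.1 ((hammingNorm_pos_iff.2 hx0).trans_le (hwt x hx))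
  have hk : Module.finrank F (D.map T) = Module.finrank F D := by
    rw [← Submodule.range_subtype D, ← LinearMap.range_comp, Submodule.range_subtype]
    refine LinearMap.finrank_range_of_inj ?_
    rw [← LinearMap.ker_eq_bot, LinearMap.ker_eq_bot']
    intro x hx
    by_contra hx0
    exact hinj x x.2 (fun h => hx0 (Subtype.ext h)) hx
  have hle : Module.finrank F D ≤ kOpt F N (minDist C) := by
    refine le_csSup (kOpt_bddAbove N _) ⟨D.map T, hk, ?_⟩
    rw [le_minDist_iff]
    rintro _ ⟨x, hx, rfl⟩ hx0
    have hx0' : x ≠ 0 := by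
      rintro rfl
      simp at hx0
    exact (minDist_le_hammingNorm (hDC x hx).1 hx0').trans (by exact_mod_cast hwt x hx)
  have := f.finrank_range_add_finrank_ker
  rw [hf] at this
  omega

end GriesmerBound

/-! ### Codes of functionals evaluated at the points outside a subspace -/

section EvaluationCodes

open Module

universe u v w

variable {F : Type v} [Field F]

/-- The code of all words `(φ (p j))_j`, where `φ` is a linear functional. -/
def evCode {V : Type w} [AddCommGroup V] [Module F V] {ι : Type u} (p : ι → V) :
    Submodule F (ι → F) :=
  LinearMap.range (LinearMap.pi fun j => Dual.eval F V (p j))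

/-- The vectors `p j` represent the points of the projective space of `V` outside `S`. -/
structure IsPointDiff {V : Type w} [AddCommGroup V] [Module F V] {ι : Type u} (p : ι → V)
    (S : Submodule F V) : Prop where
  notMem : ∀ j, p j ∉ S
  eq_of_smul : ∀ j j' (a : F), p j = a • p j' → j = j'
  exists_smul : ∀ v, v ∉ S → ∃ (j : ι) (a : F), v = a • p j

variable {V : Type w} [AddCommGroup V] [Module F V]

theorem Submodule.finrank_comap_subtype' (W S : Submodule F V) :
    finrank F (S.comap W.subtype) = finrank F (W ⊓ S : Submodule F V) := by
  rw [← Submodule.map_comap_subtype]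
  exact LinearEquiv.finrank_eq (Submodule.equivMapOfInjective _ W.injective_subtype _)

theorem finrank_sup_span_singleton_of_notMem [FiniteDimensional F V] {W : Submodule F V} {v : V}
    (hv : v ∉ W) : finrank F (W ⊔ Submodule.span F {v} : Submodule F V) = finrank F W + 1 := by
  have hv0 : v ≠ 0 := by
    rintro rfl
    exact hv W.zero_mem
  rw [← finrank_span_singleton (K := F) hv0]
  have h := Submodule.finrank_sup_add_finrank_inf_eq W (Submodule.span F {v})
  rw [((Submodule.disjoint_span_singleton' hv0).2 hv).eq_bot, finrank_bot] at h
  exact h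

/-- Between two subspaces there are subspaces of every dimension in between. -/
theorem Submodule.exists_between_finrank_eq [FiniteDimensional F V] {A B : Submodule F V}
    (hAB : A ≤ B) {k : ℕ} (hA : finrank F A ≤ k) (hB : k ≤ finrank F B) :
    ∃ J : Submodule F V, A ≤ J ∧ J ≤ B ∧ finrank F J = k := by
  induction k, hA using Nat.le_induction with
  | base => exact ⟨A, le_rfl, hAB, rfl⟩
  | succ k _ ih =>
    obtain ⟨J, hAJ, hJB, hJ⟩ := ih (by omega)
    have hne : ¬ B ≤ J := fun h => by
      have := Submodule.finrank_mono h
      omega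
    obtain ⟨v, hvB, hvJ⟩ := SetLike.not_le_iff_exists.1 hne
    refine ⟨J ⊔ Submodule.span F {v}, hAJ.trans le_sup_left, sup_le hJB ?_, ?_⟩
    · rwa [Submodule.span_singleton_le_iff_mem]
    · rw [finrank_sup_span_singleton_of_notMem hvJ, hJ]

/-- Through a vector outside `S` there are subspaces that meet `S` in a subspace of prescribed
dimension. -/
theorem Submodule.exists_mem_finrank_inf_eq [FiniteDimensional F V] {S : Submodule F V} {v : V}
    (hv : v ∉ S) {κ i : ℕ} (hi : i ≤ finrank F S) (hiκ : i < κ)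
    (hκ : finrank F S + κ ≤ finrank F V + i) :
    ∃ W : Submodule F V, v ∈ W ∧ finrank F W = κ ∧ finrank F (W ⊓ S : Submodule F V) = i := by
  have hv0 : v ≠ 0 := by
    rintro rfl
    exact hv S.zero_mem
  -- Take `W = I ⊔ J`, with `I` inside `S` of dimension `i` and `J` of dimension `κ - i` through `v`
  -- inside a complement `T` of `S`. The modular law then gives `W ⊓ S = I`.
  obtain ⟨I, -, hIS, hI⟩ := Submodule.exists_between_finrank_eq (bot_le : ⊥ ≤ S) (k := i)
    (by simp) hi
  obtain ⟨T, hvT, hT⟩ := ((Submodule.disjoint_span_singleton' hv0).2 hv).symm.exists_isCompl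
  have hTS := Submodule.finrank_add_eq_of_isCompl hT
  obtain ⟨J, hvJ, hJT, hJ⟩ := Submodule.exists_between_finrank_eq hvT (k := κ - i)
    (by rw [finrank_span_singleton hv0]; omega) (by omega)
  have hJS : Disjoint J S := hT.disjoint.mono_left hJT
  have hinf : (I ⊔ J) ⊓ S = I := by
    rw [sup_inf_assoc_of_le J hIS, hJS.eq_bot, sup_bot_eq]
  refine ⟨I ⊔ J, Submodule.mem_sup_right (hvJ (Submodule.mem_span_singleton_self v)), ?_, ?_⟩
  · have h := Submodule.finrank_sup_add_finrank_inf_eq I J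
    rw [(hJS.symm.mono_left hIS).eq_bot, finrank_bot] at h
    omega
  · rw [hinf, hI]

/-- The restriction of an evaluation code to the points in a subspace. -/
theorem codeRestrict_evCode {ι : Type u} (p : ι → V) (W : Submodule F V) {I : Finset ι}
    (hI : ∀ j ∈ I, p j ∈ W) :
    codeRestrict (evCode p) I = evCode (F := F) fun j : I => (⟨p j, hI j j.2⟩ : W) := by
  ext x
  constructor
  · rintro ⟨_, ⟨φ, rfl⟩, rfl⟩
    exact ⟨φ.comp W.subtype, rfl⟩
  · rintro ⟨φ, rfl⟩
    -- Every functional on `W` extends to `V`, so restriction loses none of the words of the smaller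
    -- code.
    obtain ⟨ψ, hψ⟩ := φ.exists_extend
    refine ⟨_, ⟨ψ, rfl⟩, ?_⟩
    funext j
    exact LinearMap.congr_fun hψ ⟨p j, hI j j.2⟩

theorem finrank_evCode_le [FiniteDimensional F V] {ι : Type u} (p : ι → V) :
    finrank F (evCode (F := F) p) ≤ finrank F V := by
  rw [← Subspace.dual_finrank_eq (K := F) (V := V)]
  exact LinearMap.finrank_range_le _

theorem diffDist_pos {q κ i : ℕ} (hq : 1 < q) (hi : i < κ) : 0 < diffDist q κ i := by
  unfold diffDist
  split_ifs with h0
  · positivity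
  · exact Nat.sub_pos_of_lt (Nat.pow_lt_pow_right hq (by omega))

namespace IsPointDiff

variable {ι : Type u} {p : ι → V} {S : Submodule F V}

theorem restrict (h : IsPointDiff p S) (W : Submodule F V) {I : Finset ι}
    (hI : ∀ j, j ∈ I ↔ p j ∈ W) :
    IsPointDiff (fun j : I => (⟨p j, (hI j).1 j.2⟩ : W)) (S.comap W.subtype) where
  notMem j := h.notMem j
  eq_of_smul j j' a hj := Subtype.ext (h.eq_of_smul j j' a (congrArg Subtype.val hj))
  exists_smul v hv := by
    obtain ⟨j, a, hj⟩ := h.exists_smul v hv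
    have ha : a ≠ 0 := by
      rintro rfl
      rw [zero_smul] at hj
      exact hv (by simp [hj])
    have hjI : j ∈ I := by
      rw [hI, ← inv_smul_smul₀ ha (p j), ← hj]
      exact W.smul_mem _ v.2
    exact ⟨⟨j, hjI⟩, a, Subtype.ext hj⟩

theorem exists_subspace_finset [FiniteDimensional F V] [Fintype ι] (h : IsPointDiff p S) {κ i : ℕ} (hi : i ≤ finrank F S)
    (hiκ : i < κ) (hκ : finrank F S + κ ≤ finrank F V + i) (j : ι) :
    ∃ W : Submodule F V, ∃ I : Finset ι, (∀ j, j ∈ I ↔ p j ∈ W) ∧ j ∈ I ∧ finrank F W = κ ∧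
      finrank F (W ⊓ S : Submodule F V) = i := by
  classical
  obtain ⟨W, hjW, hW, hWS⟩ := Submodule.exists_mem_finrank_inf_eq (h.notMem j) hi hiκ hκ
  exact ⟨W, Finset.univ.filter fun j => p j ∈ W, by simp, by simpa using hjW, hW, hWS⟩

variable [Fintype F] [FiniteDimensional F V] [Fintype ι]

/-- Every vector outside `S` is a unique nonzero multiple of a unique `p j`. The additive form
avoids truncated subtraction and division. -/
theorem card_mul (h : IsPointDiff p S) :
    Fintype.card ι * (Fintype.card F - 1) + Fintype.card F ^ finrank F S =
      Fintype.card F ^ finrank F V := by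
  classical
  have : Finite V := Module.finite_of_finite F
  have hb : Function.Bijective
      (fun x : ι × Fˣ => (⟨x.2 • p x.1, fun hx => h.notMem x.1 ((S.smul_mem_iff_of_isUnit
        x.2.isUnit).1 hx)⟩ : {v // v ∉ S})) := by
    constructor
    · rintro ⟨j, a⟩ ⟨j', a'⟩ hx
      have hx' : a • p j = a' • p j' := congrArg Subtype.val hx
      have hj : j = j' := by
        refine h.eq_of_smul j j' (a⁻¹ * a' : Fˣ) ?_
        rw [← inv_smul_smul a (p j), hx', smul_smul]
        rfl
      subst hj
      have hp : p j ≠ 0 := fun h0 => h.notMem j (h0 ▸ S.zero_mem)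
      have : (a : F) = a' := smul_left_injective F hp hx'
      rw [Units.ext this]
    · rintro ⟨v, hv⟩
      obtain ⟨j, a, hj⟩ := h.exists_smul v hv
      have ha : a ≠ 0 := by
        rintro rfl
        rw [zero_smul] at hj
        exact hv (by simp [hj])
      exact ⟨(j, Units.mk0 a ha), Subtype.ext hj.symm⟩
  have h1 := Nat.card_congr (Equiv.ofBijective _ hb)
  rw [Nat.card_prod, Nat.card_eq_fintype_card, Nat.card_eq_fintype_card, Fintype.card_units] at h1
  rw [h1, ← Nat.card_eq_fintype_card, ← Module.natCard_eq_pow_finrank,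
    ← Module.natCard_eq_pow_finrank, add_comm]
  exact Set.ncard_add_ncard_compl (S : Set V)

theorem card_eq_diffLength (h : IsPointDiff p S) :
    Fintype.card ι = diffLength (Fintype.card F) (finrank F V) (finrank F S) := by
  have hq : 1 < Fintype.card F := Fintype.one_lt_card
  rw [diffLength, ← h.card_mul, Nat.add_sub_cancel, Nat.mul_div_cancel _ (by omega)]

variable [DecidableEq F]

/-- The zeros of the word are the points lying in the hyperplane `ker φ`. They form a configuration
of the same kind inside it, so `card_mul` counts both them and all points. -/
theorem hammingNorm_mul (h : IsPointDiff p S) {φ : Dual F V} (hφ : φ ≠ 0) :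
    hammingNorm (fun j => φ (p j)) * (Fintype.card F - 1) + Fintype.card F ^ (finrank F V - 1) +
        Fintype.card F ^ finrank F S =
      Fintype.card F ^ finrank F V +
        Fintype.card F ^ finrank F (LinearMap.ker φ ⊓ S : Submodule F V) := by
  classical
  let I : Finset ι := Finset.univ.filter fun j => φ (p j) = 0
  have h1 := (h.restrict (LinearMap.ker φ) (I := I) (by simp [I])).card_mul
  have h2 := h.card_mul
  have h3 := Module.Dual.finrank_ker_add_one_of_ne_zero hφ
  have h4 : I.card + hammingNorm (fun j => φ (p j)) = Fintype.card ι :=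
    Finset.card_filter_add_card_filter_not _
  rw [Submodule.finrank_comap_subtype', Fintype.card_coe,
    show finrank F (LinearMap.ker φ) = finrank F V - 1 by omega] at h1
  rw [← h2, ← h4, ← h1]
  ring

theorem hammingNorm_of_le (h : IsPointDiff p S) {φ : Dual F V} (hφ : φ ≠ 0)
    (hS : S ≤ LinearMap.ker φ) :
    hammingNorm (fun j => φ (p j)) = Fintype.card F ^ (finrank F V - 1) := by
  have h1 := h.hammingNorm_mul hφ
  rw [inf_eq_right.2 hS] at h1
  have h3 := Module.Dual.finrank_ker_add_one_of_ne_zero hφ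
  obtain ⟨k, hk⟩ : ∃ k, finrank F V = k + 1 := ⟨_, h3.symm⟩
  obtain ⟨q, hq⟩ : ∃ q, Fintype.card F = q + 2 :=
    ⟨_, (Nat.sub_add_cancel Fintype.one_lt_card).symm⟩
  rw [hk, hq] at h1
  rw [hk, hq]
  simp only [Nat.add_sub_cancel, show q + 2 - 1 = q + 1 from rfl, pow_succ] at h1 ⊢
  refine Nat.eq_of_mul_eq_mul_right (Nat.succ_pos q) ?_
  linarith

theorem hammingNorm_of_not_le (h : IsPointDiff p S) {φ : Dual F V} (hS : ¬ S ≤ LinearMap.ker φ) :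
    hammingNorm (fun j => φ (p j)) + Fintype.card F ^ (finrank F S - 1) =
      Fintype.card F ^ (finrank F V - 1) := by
  have hφ : φ ≠ 0 := by
    rintro rfl
    exact hS fun x _ => by simp
  have h1 := h.hammingNorm_mul hφ
  have h3 := Module.Dual.finrank_ker_add_one_of_ne_zero hφ
  -- Hence `ker φ` cuts `S` in a hyperplane of `S`.
  have hφS : φ.domRestrict S ≠ 0 := fun h0 => hS fun x hx => LinearMap.congr_fun h0 ⟨x, hx⟩
  have h4 := Module.Dual.finrank_ker_add_one_of_ne_zero hφS
  rw [LinearMap.ker_domRestrict, Submodule.finrank_comap_subtype', inf_comm] at h4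
  obtain ⟨k, hk⟩ : ∃ k, finrank F V = k + 1 := ⟨_, h3.symm⟩
  obtain ⟨q, hq⟩ : ∃ q, Fintype.card F = q + 2 :=
    ⟨_, (Nat.sub_add_cancel Fintype.one_lt_card).symm⟩
  rw [← h4, hk, hq] at h1
  rw [← h4, hk, hq]
  simp only [Nat.add_sub_cancel, show q + 2 - 1 = q + 1 from rfl, pow_succ] at h1 ⊢
  refine Nat.eq_of_mul_eq_mul_right (Nat.succ_pos q) ?_
  linarith

theorem diffDist_le_hammingNorm (h : IsPointDiff p S) {φ : Dual F V} (hφ : φ ≠ 0) :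
    diffDist (Fintype.card F) (finrank F V) (finrank F S) ≤ hammingNorm (fun j => φ (p j)) := by
  unfold diffDist
  by_cases hS : S ≤ LinearMap.ker φ
  · rw [h.hammingNorm_of_le hφ hS]
    split_ifs <;> omega
  · have h1 := h.hammingNorm_of_not_le hS
    have h0 : finrank F S ≠ 0 := fun h0 => hS <| by
      rw [Submodule.finrank_eq_zero.1 h0]
      exact bot_le
    rw [if_neg h0]
    omega

/-- The lighter words come from functionals that do not vanish on `S`. These exist exactly when `S`
is nonzero, whence the two cases of `diffDist`. -/
theorem exists_hammingNorm_eq (h : IsPointDiff p S) (hS : finrank F S < finrank F V) :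
    ∃ φ : Dual F V, φ ≠ 0 ∧ hammingNorm (fun j => φ (p j)) =
      diffDist (Fintype.card F) (finrank F V) (finrank F S) := by
  unfold diffDist
  split_ifs with h0
  · have hne : S ≠ ⊤ := by
      rintro rfl
      simp at hS
    obtain ⟨v, -, hv⟩ := SetLike.exists_of_lt hne.lt_top
    obtain ⟨φ, hφ, hφS⟩ := Submodule.exists_le_ker_of_notMem hv
    have hφ0 : φ ≠ 0 := by
      rintro rfl
      simp at hφ
    exact ⟨φ, hφ0, h.hammingNorm_of_le hφ0 hφS⟩
  · have hne : S ≠ ⊥ := by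
      rintro rfl
      simp at h0
    obtain ⟨v, hvS, hv⟩ := S.ne_bot_iff.1 hne
    obtain ⟨φ, hφ, -⟩ := Submodule.exists_le_ker_of_notMem
      (p := (⊥ : Submodule F V)) (v := v) (by simpa using hv)
    have hφ0 : φ ≠ 0 := by
      rintro rfl
      simp at hφ
    have := h.hammingNorm_of_not_le (φ := φ) fun hle => hφ (hle hvS)
    exact ⟨φ, hφ0, by omega⟩

theorem minDist_evCode (h : IsPointDiff p S) (hS : finrank F S < finrank F V) :
    minDist (evCode (F := F) p) =
      (diffDist (Fintype.card F) (finrank F V) (finrank F S) : ℕ∞) := by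
  apply le_antisymm
  · obtain ⟨φ, hφ, hw⟩ := h.exists_hammingNorm_eq hS
    rw [← hw]
    refine minDist_le_hammingNorm ⟨φ, rfl⟩ (hammingNorm_pos_iff.1 ?_)
    rw [hw]
    exact diffDist_pos Fintype.one_lt_card hS
  · rw [le_minDist_iff]
    rintro _ ⟨φ, rfl⟩ hx
    have hφ : φ ≠ 0 := by
      rintro rfl
      exact hx (map_zero _)
    exact_mod_cast h.diffDist_le_hammingNorm hφ

theorem finrank_evCode (h : IsPointDiff p S) (hS : finrank F S < finrank F V) :
    finrank F (evCode (F := F) p) = finrank F V := by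
  rw [← Subspace.dual_finrank_eq (K := F) (V := V)]
  refine LinearMap.finrank_range_of_inj ?_
  rw [← LinearMap.ker_eq_bot, LinearMap.ker_eq_bot']
  intro φ hφ
  by_contra hφ0
  have h1 := h.diffDist_le_hammingNorm hφ0
  have h2 : hammingNorm (fun j => φ (p j)) = 0 := hammingNorm_eq_zero.2 hφ
  have := diffDist_pos (q := Fintype.card F) Fintype.one_lt_card hS
  omega

theorem hasParams_evCode (h : IsPointDiff p S) (hS : finrank F S < finrank F V) :
    HasParams (evCode (F := F) p) (diffLength (Fintype.card F) (finrank F V) (finrank F S))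
      (finrank F V) (diffDist (Fintype.card F) (finrank F V) (finrank F S)) :=
  ⟨h.card_eq_diffLength, h.finrank_evCode hS, h.minDist_evCode hS⟩

omit [Fintype ι] in
/-- The restriction to the points of a subspace. -/
theorem hasParams_codeRestrict (h : IsPointDiff p S) {W : Submodule F V} {I : Finset ι}
    (hI : ∀ j, j ∈ I ↔ p j ∈ W) {κ i : ℕ} (hW : finrank F W = κ)
    (hWS : finrank F (W ⊓ S : Submodule F V) = i) (hi : i < κ) :
    HasParams (codeRestrict (evCode (F := F) p) I) (diffLength (Fintype.card F) κ i) κ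
      (diffDist (Fintype.card F) κ i) := by
  have h' := h.restrict W hI
  have hS := Submodule.finrank_comap_subtype' W S
  have := h'.hasParams_evCode (by omega)
  rw [hS, hWS, hW] at this
  rwa [codeRestrict_evCode p W fun j hj => (hI j).1 hj]

end IsPointDiff

end EvaluationCodes

/-! ### The code `S(m) - S(s)` as an evaluation code -/

section SimplexDifference

open Module

universe u v

variable {F : Type v} [Field F]

/-- Prepending zeros as a linear map. -/
def prependZerosHom (F : Type v) [Field F] (s m : ℕ) : (Fin s → F) →ₗ[F] (Fin m → F) where
  toFun := prependZeros m
  map_add' x y := by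
    funext i
    simp only [prependZeros, Pi.add_apply]
    split_ifs <;> simp
  map_smul' a x := by
    funext i
    simp only [prependZeros, Pi.smul_apply, RingHom.id_apply]
    split_ifs <;> simp

theorem prependZerosHom_injective {s m : ℕ} (hs : s ≤ m) :
    Function.Injective (prependZerosHom F s m) := by
  intro x y hxy
  funext i
  have h := congrFun hxy ⟨i.val + (m - s), by have := i.isLt; omega⟩
  simpa [prependZerosHom, prependZeros] using h

theorem finrank_range_prependZerosHom {s m : ℕ} (hs : s ≤ m) :
    finrank F (LinearMap.range (prependZerosHom F s m)) = s := by
  rw [LinearMap.finrank_range_of_inj (prependZerosHom_injective hs), finrank_fin_fun]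

variable {m s : ℕ} {ι : Type u} [Fintype ι] {ι' : Type*} {G : Matrix (Fin m) ι F}
  {G' : Matrix (Fin s) ι' F}

/-- The columns of `G'` represent all points of `F ^ s`, so the deleted columns of `G` are precisely
those in the image of `F ^ s` under prepending zeros. This image plays the role of `S`. -/
theorem mem_remainingColumns (hG : IsSimplexMatrix G) (hG' : IsSimplexMatrix G') (j : ι) :
    j ∈ remainingColumns G G' ↔ G.col j ∉ LinearMap.range (prependZerosHom F s m) := by
  classical
  rw [remainingColumns, Finset.mem_filter, and_iff_right (Finset.mem_univ j), not_iff_not]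
  constructor
  · rintro ⟨t, a, -, h⟩
    exact ⟨a • G'.col t, (map_smul _ _ _).trans h.symm⟩
  · rintro ⟨w, hw⟩
    have hw0 : w ≠ 0 := by
      rintro rfl
      exact hG.1 j (by rw [← hw, map_zero])
    obtain ⟨t, a, rfl⟩ := hG'.2.2 w hw0
    refine ⟨t, a, ?_, ?_⟩
    · rintro rfl
      simp at hw0
    · rw [← hw, map_smul]
      rfl

theorem isPointDiff_remainingColumns (hG : IsSimplexMatrix G) (hG' : IsSimplexMatrix G') :
    IsPointDiff (fun j : remainingColumns G G' => G.col (j : ι))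
      (LinearMap.range (prependZerosHom F s m)) where
  notMem j := (mem_remainingColumns hG hG' j).1 j.2
  eq_of_smul j j' a h := by
    by_contra hne
    have hli := LinearIndependent.pair_iff.1 (hG.2.1 j j' fun h => hne (Subtype.ext h)) 1 (-a)
      (by rw [h, one_smul, neg_smul, add_neg_cancel])
    exact one_ne_zero hli.1
  exists_smul v hv := by
    have hv0 : v ≠ 0 := by
      rintro rfl
      exact hv (zero_mem _)
    obtain ⟨j, a, rfl⟩ := hG.2.2 v hv0
    exact ⟨⟨j, (mem_remainingColumns hG hG' j).2 fun h => hv (Submodule.smul_mem _ a h)⟩, a, rfl⟩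

/-- The rows of the generator matrix are the words of the coordinate functionals, which span the
dual space. -/
theorem simplexDiff_eq_evCode (G : Matrix (Fin m) ι F) (G' : Matrix (Fin s) ι' F) :
    simplexDiff G G' = evCode (F := F) fun j : remainingColumns G G' => G.col (j : ι) := by
  apply le_antisymm
  · rw [simplexDiff, Submodule.span_le]
    rintro _ ⟨i, rfl⟩
    exact ⟨LinearMap.proj i, rfl⟩
  · rintro _ ⟨φ, rfl⟩
    have : (LinearMap.pi fun j : remainingColumns G G' => Dual.eval F (Fin m → F) (G.col j)) φ =
        ∑ i, φ (Pi.single i 1) •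
          (G.submatrix id (Subtype.val : remainingColumns G G' → ι)).row i := by
      funext j
      rw [Finset.sum_apply]
      simp only [LinearMap.pi_apply, Dual.eval_apply]
      conv_lhs => rw [LinearMap.pi_apply_eq_sum_univ φ (G.col (j : ι))]
      refine Finset.sum_congr rfl fun i _ => ?_
      rw [Pi.smul_apply, smul_eq_mul, smul_eq_mul, mul_comm]
      congr 2
      funext k
      simp [Pi.single_apply, eq_comm]
    rw [this]
    exact Submodule.sum_mem _ fun i _ => Submodule.smul_mem _ _ (Submodule.subset_span ⟨i, rfl⟩)

end SimplexDifference

/-! ### Griesmer sums of the distances, and upper bounds for `μ` and `ν` -/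

section Arithmetic

/-- For `t < i` the division is exact. For `0 < i ≤ t` the subtracted fraction `q ^ (i - 1) / q ^ t`
lies strictly between `0` and `1`, and the ceiling absorbs it. -/
theorem ceil_diffDist_div {q κ i t : ℕ} (hq : 1 < q) (hi : i < κ) (ht : t < κ) :
    ⌈(diffDist q κ i : ℚ) / (q : ℚ) ^ t⌉₊ + (if t < i then q ^ (i - 1 - t) else 0) =
      q ^ (κ - 1 - t) := by
  have hq0 : (0 : ℚ) < (q : ℚ) ^ t := by positivity
  have hκ : q ^ (κ - 1) = q ^ (κ - 1 - t) * q ^ t := by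
    rw [← pow_add]
    congr 1
    omega
  have hpos : 0 < q ^ (κ - 1 - t) := by positivity
  unfold diffDist
  split_ifs with h0 hti hti
  · omega
  · rw [hκ, Nat.cast_mul, Nat.cast_pow q t, mul_div_cancel_right₀ _ hq0.ne', Nat.ceil_natCast,
      add_zero]
  · have hi' : q ^ (i - 1) = q ^ (i - 1 - t) * q ^ t := by
      rw [← pow_add]
      congr 1
      omega
    rw [hκ, hi', ← Nat.sub_mul, Nat.cast_mul, Nat.cast_pow q t, mul_div_cancel_right₀ _ hq0.ne',
      Nat.ceil_natCast]
    exact Nat.sub_add_cancel (Nat.pow_le_pow_right (by omega) (by omega))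
  · rw [add_zero, Nat.ceil_eq_iff hpos.ne', lt_div_iff₀ hq0, div_le_iff₀ hq0,
      Nat.cast_sub (Nat.pow_le_pow_right (by omega) (by omega)), hκ,
      Nat.cast_sub (by omega : 1 ≤ q ^ (κ - 1 - t))]
    have h1 : ((q ^ (i - 1) : ℕ) : ℚ) < (q : ℚ) ^ t := by
      rw [← Nat.cast_pow, Nat.cast_lt]
      exact Nat.pow_lt_pow_right hq (by omega)
    have h2 : (0 : ℚ) ≤ ((q ^ (i - 1) : ℕ) : ℚ) := by positivity
    push_cast at h1 h2 ⊢
    constructor <;> linarith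

/-- Two geometric series, summed without subtraction of powers. The truncated exponent `i - t` stops
the second one once `t` reaches `i`. -/
theorem griesmer_diffDist {q κ i t : ℕ} (hq : 1 < q) (hi : i < κ) (ht : t ≤ κ) :
    griesmer q t (diffDist q κ i) * (q - 1) + q ^ (κ - t) + q ^ i = q ^ κ + q ^ (i - t) := by
  induction t with
  | zero => simp [griesmer]
  | succ t ih =>
    have h1 := ceil_diffDist_div hq hi (t := t) (by omega)
    have h2 := ih (by omega)
    have h3 : griesmer q (t + 1) (diffDist q κ i) =
        griesmer q t (diffDist q κ i) + ⌈(diffDist q κ i : ℚ) / (q : ℚ) ^ t⌉₊ :=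
      Finset.sum_range_succ _ _
    obtain ⟨r, rfl⟩ : ∃ r, q = r + 1 := ⟨q - 1, by omega⟩
    have h4 : (r + 1) ^ (κ - t) = (r + 1) ^ (κ - 1 - t) * (r + 1) := by
      rw [← pow_succ]
      congr 1
      omega
    rw [h3, show κ - (t + 1) = κ - 1 - t by omega]
    simp only [Nat.add_sub_cancel] at h2 ⊢
    rw [h4] at h2
    split_ifs at h1 with hti
    · have h5 : (r + 1) ^ (i - t) = (r + 1) ^ (i - 1 - t) * (r + 1) := by
        rw [← pow_succ]
        congr 1
        omega
      rw [h5] at h2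
      rw [show i - (t + 1) = i - 1 - t by omega]
      rw [← h1] at h2 ⊢
      linarith
    · rw [show i - (t + 1) = i - t by omega]
      rw [add_zero] at h1
      rw [← h1] at h2 ⊢
      linarith

theorem griesmer_diffDist_self {q κ i : ℕ} (hq : 1 < q) (hi : i < κ) :
    griesmer q κ (diffDist q κ i) * (q - 1) + q ^ i = q ^ κ := by
  have := griesmer_diffDist hq hi le_rfl
  rw [Nat.sub_self, Nat.sub_eq_zero_of_le hi.le] at this
  omega

theorem diffDist_sub_of_le {q κ c : ℕ} (h : κ ≤ c) : diffDist q κ (κ - c) = q ^ (κ - 1) := by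
  rw [Nat.sub_eq_zero_of_le h, diffDist, if_pos rfl]

theorem diffDist_sub_add {q κ c : ℕ} (hq : 1 < q) (h : c < κ) :
    diffDist q κ (κ - c) + q ^ (κ - c - 1) = q ^ (κ - 1) := by
  rw [diffDist, if_neg (by omega)]
  exact Nat.sub_add_cancel (Nat.pow_le_pow_right (by omega) (by omega))

/-- The number of vectors outside `S` in a subspace that meets `S` as little as possible. -/
theorem sum_diffDist {q c : ℕ} (hq : 1 < q) (_hc : 1 ≤ c) (l : ℕ) :
    (∑ t ∈ Finset.range l, diffDist q (t + 1) (t + 1 - c)) * (q - 1) + q ^ (l - c) = q ^ l := by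
  induction l with
  | zero => simp
  | succ l ih =>
    rw [Finset.sum_range_succ]
    obtain ⟨r, rfl⟩ : ∃ r, q = r + 1 := ⟨q - 1, by omega⟩
    simp only [Nat.add_sub_cancel] at ih ⊢
    rcases Nat.lt_or_ge c (l + 1) with h | h
    · have h1 := diffDist_sub_add hq h
      rw [show l + 1 - c - 1 = l - c by omega, Nat.add_sub_cancel] at h1
      rw [show l + 1 - c = (l - c) + 1 by omega, pow_succ, pow_succ] at *
      rw [← h1] at ih ⊢
      linarith
    · rw [diffDist_sub_of_le h, Nat.sub_eq_zero_of_le h]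
      rw [Nat.sub_eq_zero_of_le (by omega)] at ih
      rw [Nat.add_sub_cancel, pow_succ]
      linarith

/-- Strictness can fail at `κ = 1`: for `q = 2` and `c = 1` both distances are `1`. This is why
`monotone_diffDist` is only weak while `strictMono_diffDist` starts at `2`. -/
theorem diffDist_lt_succ {q c κ : ℕ} (hq : 1 < q) (hc : 1 ≤ c) (hκ : 2 ≤ κ) :
    diffDist q κ (κ - c) < diffDist q (κ + 1) (κ + 1 - c) := by
  obtain ⟨k, rfl⟩ : ∃ k, κ = k + 1 := ⟨κ - 1, by omega⟩
  have hk : 2 ≤ q ^ k := hq.trans_le (Nat.le_self_pow (by omega) q)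
  have hk2 : 2 * q ^ k ≤ q ^ (k + 1) := by
    rw [pow_succ']
    exact Nat.mul_le_mul_right _ hq
  rcases lt_trichotomy c (k + 1) with h | h | h
  · have h1 := diffDist_sub_add hq h
    have h2 := diffDist_sub_add hq (show c < k + 1 + 1 by omega)
    have h3 : 0 < diffDist q (k + 1) (k + 1 - c) := diffDist_pos hq (by omega)
    rw [show k + 1 + 1 - c - 1 = (k + 1 - c - 1) + 1 by omega, Nat.add_sub_cancel, pow_succ,
      pow_succ] at h2
    rw [Nat.add_sub_cancel] at h1
    rw [← h1] at h2
    nlinarith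
  · have h2 := diffDist_sub_add hq (show c < k + 1 + 1 by omega)
    rw [show k + 1 + 1 - c - 1 = 0 by omega, pow_zero, Nat.add_sub_cancel] at h2
    rw [diffDist_sub_of_le (by omega), Nat.add_sub_cancel]
    omega
  · rw [diffDist_sub_of_le (by omega), diffDist_sub_of_le (by omega), Nat.add_sub_cancel,
      Nat.add_sub_cancel]
    omega

theorem diffDist_one {q c : ℕ} (hc : 1 ≤ c) : diffDist q 1 (1 - c) = 1 := by
  rw [diffDist_sub_of_le hc, Nat.sub_self, pow_zero]

theorem monotone_diffDist {q c : ℕ} (hq : 1 < q) (hc : 1 ≤ c) :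
    Monotone fun t => diffDist q (t + 1) (t + 1 - c) := by
  refine monotone_nat_of_le_succ fun t => ?_
  rcases Nat.eq_zero_or_pos t with rfl | ht
  · rw [zero_add, diffDist_one hc]
    exact diffDist_pos hq (by omega)
  · exact (diffDist_lt_succ hq hc (by omega)).le

/-- Partial sums of a nondecreasing sequence are superadditive: peel off the first `κ` terms and
shift the remaining ones down. -/
theorem Monotone.mul_sum_range_add_le {e : ℕ → ℕ} (he : Monotone e) (κ b a : ℕ) :
    a * ∑ t ∈ Finset.range κ, e t + ∑ t ∈ Finset.range b, e t ≤
      ∑ t ∈ Finset.range (κ * a + b), e t := by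
  induction a with
  | zero => simp
  | succ a ih =>
    rw [show κ * (a + 1) + b = κ + (κ * a + b) by ring, Finset.sum_range_add]
    have : ∑ t ∈ Finset.range (κ * a + b), e t ≤ ∑ t ∈ Finset.range (κ * a + b), e (κ + t) :=
      Finset.sum_le_sum fun t _ => he (Nat.le_add_left _ _)
    linarith

/-- With `l = a κ + b`, `μ(l)` is `a` copies of `G_q(κ, δ)` plus a remainder `z`. Multiplied by `q -
1` these are `q ^ κ - q ^ i` and `q ^ b - q ^ (i - (κ - b))`. Since `i ≥ κ - c`, they are at most `q
- 1` times the sums of the first `κ` and the first `b` terms of `e`, and superadditivity assembles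
the blocks. -/
theorem lrcMu_mul_add_le {q c κ i : ℕ} (hq : 1 < q) (hc : 1 ≤ c) (hi : i < κ) (hic : κ ≤ i + c)
    (l : ℕ) : lrcMu q κ (diffDist q κ i) l * (q - 1) + q ^ (l - c) ≤ q ^ l := by
  have hb : l % κ < κ := Nat.mod_lt _ (by omega)
  have h1 := griesmer_diffDist_self hq hi
  have h2 := griesmer_diffDist hq hi (Nat.sub_le κ (l % κ))
  rw [show κ - (κ - l % κ) = l % κ by omega] at h2
  have hD := fun x => sum_diffDist hq hc (l := x)
  have hsup := (monotone_diffDist hq hc).mul_sum_range_add_le κ (l % κ) (l / κ)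
  rw [Nat.div_add_mod] at hsup
  have hsup' := Nat.mul_le_mul_right (q - 1) hsup
  have hl := hD l
  have hκ := hD κ
  have hb' := hD (l % κ)
  have h3 : q ^ (κ - c) ≤ q ^ i := Nat.pow_le_pow_right (by omega) (by omega)
  have h4 : q ^ (l % κ - c) ≤ q ^ (i - (κ - l % κ)) :=
    Nat.pow_le_pow_right (by omega) (by omega)
  have h5 : griesmer q (κ - l % κ) (diffDist q κ i) ≤ griesmer q κ (diffDist q κ i) :=
    griesmer_mono_left _ _ (Nat.sub_le _ _)
  obtain ⟨z, hz⟩ := Nat.exists_eq_add_of_le h5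
  have hmu : lrcMu q κ (diffDist q κ i) l = l / κ * griesmer q κ (diffDist q κ i) + z := by
    rw [lrcMu, Nat.succ_mul]
    omega
  rw [hmu]
  have h6 : griesmer q κ (diffDist q κ i) * (q - 1) ≤
      (∑ t ∈ Finset.range κ, diffDist q (t + 1) (t + 1 - c)) * (q - 1) := by omega
  have h7 : z * (q - 1) ≤
      (∑ t ∈ Finset.range (l % κ), diffDist q (t + 1) (t + 1 - c)) * (q - 1) := by
    have : griesmer q κ (diffDist q κ i) * (q - 1) =
        griesmer q (κ - l % κ) (diffDist q κ i) * (q - 1) + z * (q - 1) := by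
      rw [hz, Nat.add_mul]
    omega
  have h8 := Nat.mul_le_mul_left (l / κ) h6
  rw [Nat.add_mul, mul_assoc] at hsup'
  rw [Nat.add_mul, mul_assoc]
  omega

theorem sum_range_add_mul_le {f g : ℕ → ℕ} {k w : ℕ} (h : ∀ t, f t ≤ g t)
    (hk : ∀ t, k ≤ t → f t + w ≤ g t) (l : ℕ) :
    (l - k) * w + ∑ t ∈ Finset.range l, f t ≤ ∑ t ∈ Finset.range l, g t := by
  induction l with
  | zero => simp
  | succ l ih =>
    rw [Finset.sum_range_succ, Finset.sum_range_succ]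
    rcases Nat.lt_or_ge l k with hl | hl
    · rw [show l + 1 - k = l - k by omega]
      have := h l
      omega
    · rw [show l + 1 - k = (l - k) + 1 by omega, Nat.succ_mul]
      have := hk l hl
      omega

/-- The parameters `(κ, δ_κ), …, (κ - h + 1, δ_{κ - h + 1})`. -/
def hierParams (q c κ h : ℕ) : List (ℕ × ℕ) :=
  (List.range h).map fun t => (κ - t, diffDist q (κ - t) (κ - t - c))

theorem diffHierParams_eq {q m s : ℕ} (hs : s ≤ m) (h : ℕ) :
    diffHierParams q m s h = hierParams q (m - s) (m - 1) h := by
  refine List.map_congr_left fun t _ => ?_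
  rw [show s + (m - 1 - t) - m = m - 1 - t - (m - s) by omega]

theorem hierParams_succ (q c κ h : ℕ) :
    hierParams q c (κ + 1) (h + 1) =
      (κ + 1, diffDist q (κ + 1) (κ + 1 - c)) :: hierParams q c κ h := by
  rw [hierParams, List.range_succ_eq_map, List.map_cons, List.map_map]
  congr 1
  refine List.map_congr_left fun t _ => ?_
  simp

theorem div_succ_le_sub (l κ : ℕ) : l / (κ + 1) ≤ l - κ := by
  rcases Nat.lt_or_ge l (κ + 1) with h | h
  · rw [Nat.div_eq_of_lt h]
    exact Nat.zero_le _
  · have h1 := Nat.div_mul_le_self l (κ + 1)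
    have h2 : 1 ≤ l / (κ + 1) := Nat.div_pos h (by omega)
    have h3 : l / (κ + 1) + κ ≤ l := by nlinarith
    omega

/-- Truncating the summands at the top level `κ` leaves room for the induction. A new top level `κ +
1` raises each summand with `t ≥ κ` by `δ_{κ+1} - δ_κ`, a gain of `l - κ` such increments, while `ν`
grows by only `l / (κ + 1)` of them. The lowest level is compared with the constant summand `1`
instead. -/
theorem hlrcNu_le_sum_min {q c : ℕ} (hq : 1 < q) (hc : 1 ≤ c) (l h : ℕ) : ∀ κ, h ≤ κ →
    hlrcNu (hierParams q c κ h) l ≤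
      ∑ t ∈ Finset.range l, diffDist q (min t (κ - 1) + 1) (min t (κ - 1) + 1 - c) := by
  have hmono := monotone_diffDist hq hc
  have hpos : ∀ t, 1 ≤ diffDist q (t + 1) (t + 1 - c) := fun t => diffDist_pos hq (by omega)
  induction h with
  | zero =>
    intro κ _
    calc l = ∑ t ∈ Finset.range l, 1 := by simp
      _ ≤ _ := Finset.sum_le_sum fun t _ => hpos _
  | succ h ih =>
    intro κ hκ
    obtain ⟨κ, rfl⟩ : ∃ k, κ = k + 1 := ⟨κ - 1, by omega⟩
    rw [hierParams_succ, Nat.add_sub_cancel]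
    have hdiv := div_succ_le_sub l κ
    rcases h with - | h
    · have := sum_range_add_mul_le (f := fun _ => 1)
        (g := fun t => diffDist q (min t κ + 1) (min t κ + 1 - c)) (k := κ)
        (w := diffDist q (κ + 1) (κ + 1 - c) - 1) (fun t => hpos _) (fun t ht => by
          have := hpos κ
          rw [min_eq_right ht]
          omega) l
      refine le_trans ?_ this
      change l + l / (κ + 1) * _ ≤ _
      rw [Finset.sum_const, Finset.card_range, smul_eq_mul, mul_one, add_comm]
      gcongr
    · obtain ⟨κ, rfl⟩ : ∃ k, κ = k + 1 := ⟨κ - 1, by omega⟩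
      have ih' := ih (κ + 1) (by omega)
      rw [hierParams_succ] at ih' ⊢
      rw [Nat.add_sub_cancel] at ih'
      have := sum_range_add_mul_le
        (f := fun t => diffDist q (min t κ + 1) (min t κ + 1 - c))
        (g := fun t => diffDist q (min t (κ + 1) + 1) (min t (κ + 1) + 1 - c)) (k := κ + 1)
        (w := diffDist q (κ + 1 + 1) (κ + 1 + 1 - c) - diffDist q (κ + 1) (κ + 1 - c))
        (fun t => hmono (min_le_min_left _ (Nat.le_succ _))) (fun t ht => by
          have h2 : diffDist q (κ + 1) (κ + 1 - c) ≤ diffDist q (κ + 1 + 1) (κ + 1 + 1 - c) :=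
            hmono (Nat.le_succ κ)
          rw [min_eq_right ht, min_eq_right (by omega)]
          omega) l
      refine le_trans ?_ this
      rw [hlrcNu]
      gcongr

theorem hlrcNu_mul_add_le {q c : ℕ} (hq : 1 < q) (hc : 1 ≤ c) {κ h : ℕ} (hκ : h ≤ κ) (l : ℕ) :
    hlrcNu (hierParams q c κ h) l * (q - 1) + q ^ (l - c) ≤ q ^ l := by
  rw [← sum_diffDist hq hc l]
  gcongr
  exact (hlrcNu_le_sum_min hq hc l h κ hκ).trans
    (Finset.sum_le_sum fun t _ => monotone_diffDist hq hc (min_le_left _ _))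

theorem hlrcNu_zero : ∀ ps : List (ℕ × ℕ), hlrcNu ps 0 = 0
  | [] => rfl
  | [(r, δ)] => by simp [hlrcNu]
  | (r, δ) :: (r', δ') :: ps => by
    rw [hlrcNu, hlrcNu_zero]
    simp

theorem strictMono_diffDist {q c : ℕ} (hq : 1 < q) (hc : 1 ≤ c) :
    StrictMono fun k => diffDist q (k + 2) (k + 2 - c) :=
  strictMono_nat_of_lt_succ fun k => diffDist_lt_succ hq hc (by omega)

theorem hierParams_pairwise {q c κ h : ℕ} (hq : 1 < q) (hc : 1 ≤ c) (hκ : h < κ) :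
    (hierParams q c κ h).Pairwise fun p p' => p'.1 ≤ p.1 ∧ p'.2 < p.2 := by
  rw [hierParams, List.pairwise_map]
  refine List.Pairwise.imp_of_mem (R := (· < ·)) ?_ List.pairwise_lt_range
  intro a b ha hb hab
  rw [List.mem_range] at ha hb
  refine ⟨by simp only; omega, ?_⟩
  have := strictMono_diffDist hq hc (show κ - b - 2 < κ - a - 2 by omega)
  simpa only [show κ - b - 2 + 2 = κ - b by omega, show κ - a - 2 + 2 = κ - a by omega] using this

theorem two_le_diffDist {q c k l : ℕ} (hq : 1 < q) (hc : 1 ≤ c) (hk : 2 ≤ k)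
    (h2 : 2 ≤ diffDist q k (k - c)) (hkl : k ≤ l) : 2 ≤ diffDist q l (l - c) := by
  have := (strictMono_diffDist hq hc).monotone (show k - 2 ≤ l - 2 by omega)
  simp only [show k - 2 + 2 = k by omega, show l - 2 + 2 = l by omega] at this
  omega

end Arithmetic

/-! ### Optimality of evaluation codes -/

section Optimality

open Module

universe u v w

variable {F : Type v} [Field F] [Fintype F] [DecidableEq F]
  {V : Type w} [AddCommGroup V] [Module F V] [FiniteDimensional F V]
  {ι : Type u} [Fintype ι] {p : ι → V} {S : Submodule F V}

namespace IsPointDiff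

theorem meetsGriesmer_evCode (h : IsPointDiff p S) (hS : finrank F S < finrank F V) :
    MeetsGriesmer (evCode (F := F) p) := by
  have hq : 1 < Fintype.card F := Fintype.one_lt_card
  refine ⟨_, h.minDist_evCode hS, ?_⟩
  rw [h.finrank_evCode hS]
  have h1 := h.card_mul
  have h2 := griesmer_diffDist_self hq hS
  exact Nat.eq_of_mul_eq_mul_right (show 0 < Fintype.card F - 1 by omega) (by omega)

/-- The condition `hμ` says that `μ l` is at most the number of points in an `l`-dimensional
subspace meeting `S` as little as possible, so shortening there gives the bound; the Griesmer bound
gives equality at `l = 0`. -/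
theorem isLeast_finrank (h : IsPointDiff p S) (hS : finrank F S < finrank F V) (μ : ℕ → ℕ)
    (hμ0 : μ 0 = 0)
    (hμ : ∀ l, μ l * (Fintype.card F - 1) + Fintype.card F ^ (l - (finrank F V - finrank F S)) ≤
      Fintype.card F ^ l) :
    IsLeast (Set.range fun l : ℕ =>
        l + kOpt F (Fintype.card ι - μ l) (minDist (evCode (F := F) p)))
      (finrank F (evCode (F := F) p)) := by
  classical
  have hq : 1 < Fintype.card F := Fintype.one_lt_card
  have hlow : ∀ l, finrank F (evCode (F := F) p) ≤
      l + kOpt F (Fintype.card ι - μ l) (minDist (evCode (F := F) p)) := by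
    intro l
    -- The subspace used for shortening contains a vector outside `S`, so `l = 0` is separate. It
    -- needs no shortening.
    rcases Nat.eq_zero_or_pos l with rfl | hl
    · exact finrank_le_add_kOpt _ ∅ (Nat.le_zero.2 finrank_zero_of_subsingleton) (by simp [hμ0])
    rcases Nat.lt_or_ge l (finrank F V) with hlV | hlV
    · have hne : S ≠ ⊤ := by
        rintro rfl
        simp at hS
      obtain ⟨v, -, hv⟩ := SetLike.exists_of_lt hne.lt_top
      obtain ⟨W, -, hW, hWS⟩ := Submodule.exists_mem_finrank_inf_eq hv (κ := l)
        (i := l - (finrank F V - finrank F S)) (by omega) (by omega) (by omega)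
      let I : Finset ι := Finset.univ.filter fun j => p j ∈ W
      have hI : ∀ j, j ∈ I ↔ p j ∈ W := by simp [I]
      refine finrank_le_add_kOpt _ I ?_ ?_
      · rw [(h.hasParams_codeRestrict hI hW hWS (by omega)).2.1]
      · have h1 := (h.restrict W hI).card_mul
        have h2 := hμ l
        rw [Submodule.finrank_comap_subtype', hWS, hW, Fintype.card_coe] at h1
        exact Nat.le_of_mul_le_mul_right (show _ * (Fintype.card F - 1) ≤ _ by omega) (by omega)
    · exact (finrank_evCode_le p).trans (hlV.trans (Nat.le_add_right _ _))
  refine ⟨⟨0, le_antisymm ?_ (hlow 0)⟩, ?_⟩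
  · simp only [hμ0, Nat.sub_zero, zero_add]
    rw [h.finrank_evCode hS, h.minDist_evCode hS]
    apply kOpt_le_of_griesmer
    obtain ⟨d, hd, hn⟩ := h.meetsGriesmer_evCode hS
    rw [h.finrank_evCode hS] at hn
    have hd' : d = diffDist (Fintype.card F) (finrank F V) (finrank F S) := by
      exact_mod_cast hd.symm.trans (h.minDist_evCode hS)
    rw [hn, ← hd']
    -- One more dimension would add a further positive term to a Griesmer sum that already equals
    -- the length.
    refine Nat.lt_of_lt_of_eq (Nat.lt_add_of_pos_right ?_) (Finset.sum_range_succ _ _).symm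
    rw [Nat.ceil_pos]
    have : 0 < d := hd' ▸ diffDist_pos hq hS
    positivity
  · rintro _ ⟨l, rfl⟩
    exact hlow l

theorem isOptimalLRC (h : IsPointDiff p S) (hS : finrank F S < finrank F V) {κ i : ℕ}
    (hi : i ≤ finrank F S) (hiκ : i < κ) (hκ : finrank F S + κ ≤ finrank F V + i)
    (h2 : 2 ≤ diffDist (Fintype.card F) κ i) :
    IsOptimalLRC (evCode (F := F) p) (diffLength (Fintype.card F) κ i) κ
      (diffDist (Fintype.card F) κ i) := by
  have hloc : ∀ j, ∃ R : Finset ι, j ∈ R ∧ HasParams (codeRestrict (evCode (F := F) p) R)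
      (diffLength (Fintype.card F) κ i) κ (diffDist (Fintype.card F) κ i) := by
    intro j
    obtain ⟨W, I, hI, hj, hW, hWS⟩ := h.exists_subspace_finset hi hiκ hκ j
    exact ⟨I, hj, h.hasParams_codeRestrict hI hW hWS hiκ⟩
  refine ⟨⟨h2, hloc⟩, fun j => ?_, h.isLeast_finrank hS _ ?_ fun l =>
    lrcMu_mul_add_le Fintype.one_lt_card (by omega) hiκ (by omega) l⟩
  · obtain ⟨R, hj, hR⟩ := hloc j
    have := hR.1
    rw [Fintype.card_coe] at this
    exact ⟨R, hj, by omega, hR.2.2.ge⟩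
  · simp [lrcMu]

end IsPointDiff

/-- The points outside a subspace have hierarchical locality through chains of subspaces. -/
theorem hasHierLocality_evCode (c : ℕ) (hc : 1 ≤ c) (n : ℕ) :
    ∀ (ps : List (ℕ × ℕ)), ps.length ≤ n →
    ∀ {V : Type w} [AddCommGroup V] [Module F V] [FiniteDimensional F V]
      {ι : Type u} [Fintype ι] {p : ι → V} {S : Submodule F V}, IsPointDiff p S →
    finrank F S = finrank F V - c → (ps.Pairwise fun x y => y.1 ≤ x.1) →
    (∀ x ∈ ps, 1 ≤ x.1 ∧ x.1 ≤ finrank F V ∧ x.2 = diffDist (Fintype.card F) x.1 (x.1 - c)) →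
    HasHierLocality ps (evCode (F := F) p) := by
  induction n with
  | zero =>
    intro ps hps V _ _ _ ι _ p S h hS hpw hx
    obtain rfl : ps = [] := List.length_eq_zero_iff.1 (by omega)
    rw [HasHierLocality]
    exact fun i => ⟨fun j => j.elim0, fun j => j.elim0⟩
  | succ n ih =>
    intro ps hps V _ _ _ ι _ p S h hS hpw hx
    rw [HasHierLocality]
    intro i
    -- With `W` of dimension `r_j` and `W ⊓ S` of dimension `r_j - c`, the relation between the two
    -- dimensions is the same as for `V` and `S`. The induction hypothesis therefore applies with
    -- `W` as ambient space and the same `c`.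
    have hex : ∀ j : Fin ps.length, ∃ W : Submodule F V, ∃ I : Finset ι,
        (∀ j, j ∈ I ↔ p j ∈ W) ∧ i ∈ I ∧ finrank F W = (ps.get j).1 ∧
        finrank F (W ⊓ S : Submodule F V) = (ps.get j).1 - c := by
      intro j
      obtain ⟨h1, h2, -⟩ := hx _ (ps.get_mem j)
      exact h.exists_subspace_finset (by omega) (by omega) (by omega) i
    choose W I hI hi hW hWS using hex
    refine ⟨I, fun j => ?_⟩
    obtain ⟨h1, h2, h3⟩ := hx _ (ps.get_mem j)
    have hpar := h.hasParams_codeRestrict (hI j) (hW j) (hWS j) (by omega)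
    refine ⟨hi j, hpar.2.1.le, ?_, ?_⟩
    · rw [hpar.2.2, h3]
    · rw [codeRestrict_evCode p (W j) fun k hk => (hI j k).1 hk]
      refine ih _ (by rw [List.length_drop]; omega) (h.restrict (W j) (hI j)) ?_
        (hpw.sublist (List.drop_sublist _ _)) fun x hxd => ?_
      · rw [Submodule.finrank_comap_subtype', hWS, hW]
      · obtain ⟨hx1, -, hx3⟩ := hx x (List.mem_of_mem_drop hxd)
        refine ⟨hx1, ?_, hx3⟩
        rw [hW]
        have hd : ps.drop j = ps.get j :: ps.drop (j + 1) := List.drop_eq_getElem_cons j.isLt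
        have hpw' := hpw.sublist (List.drop_sublist j ps)
        rw [hd, List.pairwise_cons] at hpw'
        exact hpw'.1 x hxd

theorem IsPointDiff.isOptimalHLRC (h : IsPointDiff p S) {c κ t : ℕ} (hc : 1 ≤ c)
    (hcS : finrank F S + c = finrank F V) (hκ : κ ≤ finrank F V) (ht : t < κ)
    (h2 : t = 0 ∨ 2 ≤ diffDist (Fintype.card F) (κ - t + 1) (κ - t + 1 - c)) :
    IsOptimalHLRC (hierParams (Fintype.card F) c κ t) (evCode (F := F) p) := by
  have hq : 1 < Fintype.card F := Fintype.one_lt_card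
  have hpw := hierParams_pairwise hq hc ht
  have hmem : ∀ x ∈ hierParams (Fintype.card F) c κ t, κ - t + 1 ≤ x.1 ∧ x.1 ≤ κ ∧ t ≠ 0 ∧
      x.2 = diffDist (Fintype.card F) x.1 (x.1 - c) := by
    intro x hx
    obtain ⟨k, hk, rfl⟩ := List.mem_map.1 hx
    rw [List.mem_range] at hk
    exact ⟨by simp only; omega, Nat.sub_le _ _, by omega, rfl⟩
  refine ⟨⟨hpw, fun x hx => ?_, ?_⟩, h.isLeast_finrank (by omega) _ (hlrcNu_zero _) fun l => ?_⟩
  · obtain ⟨h3, -, h5, h6⟩ := hmem x hx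
    rw [h6]
    exact two_le_diffDist hq hc (by omega) (h2.resolve_left h5) h3
  · refine hasHierLocality_evCode c hc _ _ le_rfl h (by omega)
      (hpw.imp fun hab => hab.1) fun x hx => ?_
    obtain ⟨h3, h4, -, h6⟩ := hmem x hx
    exact ⟨by omega, by omega, h6⟩
  · rw [show finrank F V - finrank F S = c by omega]
    exact hlrcNu_mul_add_le hq hc ht.le l

end Optimality

/-! ### The theorem for `S(m) - S(s)` -/

theorem mainTheorem9 {F : Type*} [Field F] [Fintype F] [DecidableEq F] (q : ℕ)
    (hq : Fintype.card F = q) (m s : ℕ) (hm : 3 ≤ m) (hs : s ≤ m - 1)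
    {ι : Type*} [Fintype ι] (G : Matrix (Fin m) ι F) (hG : IsSimplexMatrix G)
    {ι' : Type*} (G' : Matrix (Fin s) ι' F) (hG' : IsSimplexMatrix G') :
    -- the parameters, which meet the Griesmer bound
    HasParams (simplexDiff G G') (diffLength q m s) m (diffDist q m s) ∧
    MeetsGriesmer (simplexDiff G G') ∧
    -- optimality for every locality
    (∀ κ i : ℕ, 3 ≤ κ → κ ≤ m - 1 → s + κ - m ≤ i → i ≤ min s (κ - 1) →
      IsOptimalLRC (simplexDiff G G') (diffLength q κ i) κ (diffDist q κ i)) ∧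
    (s ≤ m - 2 → IsOptimalLRC (simplexDiff G G') (q + 1) 2 q) ∧
    (2 < q → 1 ≤ s → IsOptimalLRC (simplexDiff G G') q 2 (q - 1)) ∧
    -- optimality for the hierarchical locality
    ((2 < q ∨ (q = 2 ∧ s < m - 1)) →
      IsOptimalHLRC (diffHierParams q m s (m - 2)) (simplexDiff G G')) ∧
    ((q = 2 ∧ s = m - 1) →
      IsOptimalHLRC (diffHierParams q m s (m - 3)) (simplexDiff G G')) := by
  subst hq
  have hq : 1 < Fintype.card F := Fintype.one_lt_card
  have h := isPointDiff_remainingColumns hG hG'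
  rw [simplexDiff_eq_evCode]
  have hsm : Module.finrank F (LinearMap.range (prependZerosHom F s m)) = s :=
    finrank_range_prependZerosHom (by omega)
  have hV : Module.finrank F (Fin m → F) = m := Module.finrank_fin_fun F
  have hlt : Module.finrank F (LinearMap.range (prependZerosHom F s m)) <
      Module.finrank F (Fin m → F) := by omega
  have hpar := h.hasParams_evCode hlt
  rw [hsm, hV] at hpar
  refine ⟨hpar, h.meetsGriesmer_evCode hlt, ?_, ?_, ?_, ?_, ?_⟩
  · intro κ i hκ hκm hi hi'
    have h1 := le_min_iff.1 hi'
    refine h.isOptimalLRC hlt (by omega) (by omega) (by omega) ?_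
    -- For `δ ≥ 2`, keep the codimension `κ - i` fixed and descend to dimension `3`, where the
    -- distance is at least `q ^ 2 - q`.
    have h2 := two_le_diffDist (q := Fintype.card F) (c := κ - i) (k := 3) (l := κ) hq
      (by omega) (by omega) ?_ hκ
    · rwa [show κ - (κ - i) = i by omega] at h2
    · rcases Nat.lt_or_ge (κ - i) 3 with h3 | h3
      · have h4 := diffDist_sub_add hq h3
        have h5 : Fintype.card F ^ (3 - (κ - i) - 1) ≤ Fintype.card F ^ 1 :=
          Nat.pow_le_pow_right (by omega) (by omega)
        rw [pow_one] at h5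
        have h6 : 2 * Fintype.card F ≤ Fintype.card F ^ 2 := by nlinarith
        rw [show 3 - 1 = 2 from rfl] at h4
        omega
      · rw [diffDist_sub_of_le h3]
        exact hq.trans_le (Nat.le_self_pow (by omega) _)
  · intro hs2
    have h1 := h.isOptimalLRC hlt (κ := 2) (i := 0) (by omega) (by omega) (by omega)
      (by simpa [diffDist] using Nat.succ_le_of_lt hq)
    have h2 : diffLength (Fintype.card F) 2 0 = Fintype.card F + 1 := by
      have h3 := Nat.sq_sub_sq (Fintype.card F) 1
      rw [one_pow] at h3
      rw [diffLength, pow_zero, h3, Nat.mul_div_cancel _ (by omega)]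
    rw [h2] at h1
    simpa [diffDist] using h1
  · intro hq2 hs1
    have h1 := h.isOptimalLRC hlt (κ := 2) (i := 1) (by omega) (by omega) (by omega)
      (by simp [diffDist]; omega)
    have h2 : diffLength (Fintype.card F) 2 1 = Fintype.card F := by
      rw [diffLength, pow_two, pow_one, ← Nat.mul_sub_one, Nat.mul_div_cancel _ (by omega)]
    rw [h2] at h1
    simpa [diffDist] using h1
  · intro hcase
    rw [diffHierParams_eq (by omega)]
    refine h.isOptimalHLRC (by omega) (by omega) (by omega) (by omega) (Or.inr ?_)
    rw [show m - 1 - (m - 2) + 1 = 2 by omega]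
    -- The smallest distance `δ_2` is `q - 1` if `s = m - 1` and `q` otherwise. It drops below `2`
    -- only for `q = 2`, `s = m - 1`.
    rcases Nat.lt_or_ge (m - s) 2 with h3 | h3
    · have h4 := diffDist_sub_add hq h3
      rw [show 2 - (m - s) - 1 = 0 by omega, pow_zero, pow_one] at h4
      omega
    · rw [diffDist_sub_of_le h3, pow_one]
      exact hq
  · rintro ⟨hq2, hs1⟩
    rw [diffHierParams_eq (by omega)]
    refine h.isOptimalHLRC (by omega) (by omega) (by omega) (by omega) (Or.inr ?_)
    -- Here `δ_2 = 1`, so the chain ends at dimension `3`, with `δ_3 = 4 - 2 = 2`. For `m = 3` the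
    -- chain is empty, but the check is the same.
    rw [show m - 1 - (m - 3) + 1 = 3 by omega, show m - s = 1 by omega, hq2]
    decide
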